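/- There is a universal constant $c_2>0$ such that the following holds. Let $V$ be a finite set of $n$ points, $G=(V,E)$ an undirected graph, $k\in\mathbb N$, and $0<\varepsilon\le 1$. A $k$-clustering is a partition of $V$ into $k$ labelled, disjoint, possibly empty sets; write $u\equiv_{\mathcal C}v$ if $u,v$ lie in the same cluster of $\mathcal C$. Put $$\operatorname{cost}_{u,v}(\mathcal C)=\mathbf 1_{(u,v)\in E}\mathbf 1_{u\not\equiv_{\mathcal C}v}+\mathbf 1_{(u,v)\notin E}\mathbf 1_{u\equiv_{\mathcal C}v},$$ let $\operatorname{cost}(\mathcal C)$ be the sum of $\operatorname{cost}_{u,v}(\mathcal C)$ over all unordered pairs of distinct points, and let $d(\mathcal C,\mathcal C')$ be the number of unordered pairs on which $\mathcal C$ and $\mathcal C'$ disagree. Fix a (pivot) $k$-clustering $\mathcal C=\{C_1,\dots,C_k\}$ with $|C_1|\ge\cdots\ge|C_k|$, and let $f(\mathcal C')=\operatorname{cost}(\mathcal C')-\operatorname{cost}(\mathcal C)$ and $f_{u,v}(\mathcal C')=\operatorname{cost}_{u,v}(\mathcal C')-\operatorname{cost}_{u,v}(\mathcal C)$. Let $q$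 be an integer with $q\ge c_2k^2\log n/\varepsilon^4$ (for instance the least one). For every $i\le j$ with $C_j\ne\emptyset$ and every $u\in C_i$, draw a sample (multiset) $S_{uj}$ of $q$ elements uniformly with repetition from $C_j$, all draws being independent, and put $$\hat f(\mathcal C')=\frac12\sum_{i=1}^k\frac{|C_i|}{q}\sum_{u\in C_i}\sum_{v\in S_{ui}}f_{u,v}(\mathcal C')+\sum_{i=1}^k\sum_{u\in C_i}\sum_{j=i+1}^k\frac{|C_j|}{q}\sum_{v\in S_{uj}}f_{u,v}(\mathcal C'),$$ where terms with $C_j=\emptyset$ are $0$, and $\hat f=0$ if $q=0$ (which can occur only if $n\le1$). Then with probability at least $1-n^{-3}$, simultaneously for all $k$-clusterings $\mathcal C'$, $$|f(\mathcal C')-\hat f(\mathcal C')|\le 3\varepsilon\, d(\mathcal C,\mathcal C'),$$ that is, $\hat f$ is a $3\varepsilon$-smooth relative regret approximation with respect to $\mathcal C$. -/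

import Mathlib

open MeasureTheory ProbabilityTheory

namespace CorrClust

/-- A `k`-clustering of `V`: a partition of `V` into `k` labelled, possibly empty, disjoint sets,
encoded by the function that sends each point to the label of its cluster. -/
abbrev Clustering (V : Type*) (k : ℕ) := V → Fin k

section

variable {V : Type*} [Fintype V] {k : ℕ}

/-- The cluster with label `j`. -/
def cluster (C : Clustering V k) (j : Fin k) : Finset V :=
  Finset.univ.filter (fun v => C v = j)

/-- The cost of a clustering on the pair `u, v`: it is `1` when the clustering and the graph
disagree on the pair, and `0` otherwise. -/
def pairCost (G : SimpleGraph V) [DecidableRel G.Adj] (C : Clustering V k) (u v : V) : ℝ :=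
  if G.Adj u v then (if C u = C v then 0 else 1) else (if C u = C v then 1 else 0)

/-- The correlation clustering cost: the number of unordered pairs of distinct points on which
the clustering and the graph disagree. -/
noncomputable def cost [DecidableEq V] (G : SimpleGraph V) [DecidableRel G.Adj]
    (C : Clustering V k) : ℝ :=
  (1 / 2) * ∑ u, ∑ v ∈ Finset.univ.filter (fun v => v ≠ u), pairCost G C u v

/-- The distance of two clusterings: the number of unordered pairs on which they disagree. -/
noncomputable def dist (C C' : Clustering V k) : ℝ :=
  (1 / 2) * ∑ u, ∑ v,
    ((if C' u = C' v ∧ C u ≠ C v then 1 else 0) + (if C u = C v ∧ C' u ≠ C' v then 1 else 0))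

/-- The relative regret of `C'` with respect to the pivot `C`. -/
noncomputable def regret [DecidableEq V] (G : SimpleGraph V) [DecidableRel G.Adj]
    (C C' : Clustering V k) : ℝ :=
  cost G C' - cost G C

/-- The contribution of the pair `u, v` to the relative regret of `C'` with respect to `C`. -/
def pairRegret (G : SimpleGraph V) [DecidableRel G.Adj] (C C' : Clustering V k) (u v : V) : ℝ :=
  pairCost G C' u v - pairCost G C u v

/-- `g` is an `η`-smooth relative regret approximation with respect to the pivot `C`. -/
def IsSmoothRegretApprox [DecidableEq V] (G : SimpleGraph V) [DecidableRel G.Adj] (η : ℝ)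
    (C : Clustering V k) (g : Clustering V k → ℝ) : Prop :=
  ∀ C' : Clustering V k, |regret G C C' - g C'| ≤ η * dist C C'

/-- The indices of the random draws: one sample for each point `u` and each label `j` that is at
least the label of the cluster of `u`, and `q` draws in each sample. An empty cluster offers
nothing to draw, so its samples are absent. -/
abbrev SampleIndex (C : Clustering V k) (q : ℕ) :=
  {p : V × Fin k // C p.1 ≤ p.2 ∧ (cluster C p.2).Nonempty} × Fin q

/-- All samples together: the value at the index `((u, j), s)` is the `s`-th element drawn in the
sample of `u` from the cluster `j`. -/
abbrev Sample (C : Clustering V k) (q : ℕ) := SampleIndex C q → V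

/-- The law of the samples: all draws are independent, and each is uniform on its cluster. -/
noncomputable def sampleLaw [MeasurableSpace V] (C : Clustering V k) (q : ℕ) :
    Measure (Sample C q) :=
  Measure.pi (fun x : SampleIndex C q => uniformOn (cluster C x.1.1.2 : Set V))

instance sampleLaw_isProbabilityMeasure [MeasurableSpace V] [DiscreteMeasurableSpace V]
    (C : Clustering V k) (q : ℕ) : IsProbabilityMeasure (sampleLaw C q) := by
  have (x : SampleIndex C q) :
      IsProbabilityMeasure (uniformOn (cluster C x.1.1.2 : Set V)) :=
    isProbabilityMeasure_uniformOn (Finset.finite_toSet _) (Finset.coe_nonempty.2 x.1.2.2)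
  unfold sampleLaw
  infer_instance

/-- The sum of `g` over the sample of `u` from the cluster `j`, counted with repetitions
(zero when there is no such sample). -/
noncomputable def sampleSum {C : Clustering V k} {q : ℕ} (S : Sample C q) (u : V) (j : Fin k)
    (g : V → ℝ) : ℝ :=
  if h : C u ≤ j ∧ (cluster C j).Nonempty then ∑ s : Fin q, g (S (⟨(u, j), h⟩, s)) else 0

/-- The estimator of the relative regret that is computed from the samples. -/
noncomputable def estimator (G : SimpleGraph V) [DecidableRel G.Adj] (C : Clustering V k) {q : ℕ}
    (S : Sample C q) (C' : Clustering V k) : ℝ :=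
  (1 / 2) * ∑ i, ((cluster C i).card : ℝ) / q *
      ∑ u ∈ cluster C i, sampleSum S u i (pairRegret G C C' u)
    + ∑ i, ∑ u ∈ cluster C i, ∑ j ∈ Finset.Ioi i,
        ((cluster C j).card : ℝ) / q * sampleSum S u j (pairRegret G C C' u)

end

end CorrClust

/-! Split the regret and the estimator into blocks of pairs in $C_i\times C_j$, $i\le j$. Let
$D_{ij}$ count the ordered pairs of the block on which $\mathcal C$ and $\mathcal C'$ disagree.
Charge the error on a block to the majorant $M_{ij}=D_{ij}+(D_{ii}+D_{jj})/(2k)$. The majorants add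
up to at most $2d(\mathcal C,\mathcal C')$, so an error of at most $\varepsilon M_{ij}$ on every
block suffices, even with $2\varepsilon$ in place of $3\varepsilon$ (`abs_regret_sub_estimator_le`).

For fixed $\mathcal C'$, a Bernstein-type bound makes a block fail with probability at most
$2\exp(-q\varepsilon^2M_{ij}/(4|C_j|))$ (`measureReal_sampleBlock_deviation_le`).

The union bound over $\mathcal C'$ rests on `exists_twoLabel_card_le`. If $m$ points of $C_i\cup
C_j$ deviate from suitable labels, constant on each of the two clusters, then $|C_j|(1+m)\le
4kM_{ij}$ as soon as $D_{ij}>0$. The failure probability is then at most $2x^{1+m}$ with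
$x=\exp(-q\varepsilon^2/(16k))$. As the block sees $\mathcal C'$ only on $C_i\cup C_j$, the other
points may take one of these labels. Summing $x^m$ over all clusterings gives at most $(1+kx)^n$,
and there are at most $k^2$ pairs of labels and $k^2$ blocks. -/

namespace CorrClust

/-! ### Exponential moments and concentration of one sampled block. -/

section Sampling

variable {V : Type*} [Fintype V] {k : ℕ}

theorem mem_cluster {C : Clustering V k} {j : Fin k} {v : V} : v ∈ cluster C j ↔ C v = j := by
  simp [cluster]

/-- The sum of `F` over the pairs with first point in the cluster `i` and second point in the
cluster `j`. -/
def blockSum (C : Clustering V k) (F : V → V → ℝ) (i j : Fin k) : ℝ :=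
  ∑ u ∈ cluster C i, ∑ v ∈ cluster C j, F u v

/-- The sum of `F` over the pairs formed by a point `u` of the cluster `i` and a draw in the sample
of `u` from the cluster `j`. -/
noncomputable def sampleBlock {C : Clustering V k} {q : ℕ} (S : Sample C q) (F : V → V → ℝ)
    (i j : Fin k) : ℝ :=
  ∑ u ∈ cluster C i, sampleSum S u j (F u)

/-- The sum over the subtype of admissible pairs is extended by zero to all pairs `(u, j)`, where it
can be split coordinate by coordinate. -/
theorem sum_sampleIndex_ite (C : Clustering V k) (q : ℕ) (i j : Fin k)
    (φ : SampleIndex C q → ℝ) :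
    ∑ x : SampleIndex C q, (if C x.1.1.1 = i ∧ x.1.1.2 = j then φ x else 0) =
      ∑ u ∈ cluster C i, if h : C u ≤ j ∧ (cluster C j).Nonempty then
        ∑ s : Fin q, φ (⟨(u, j), h⟩, s) else 0 := by
  rw [Fintype.sum_prod_type]
  let P : V × Fin k → Prop := fun p => C p.1 ≤ p.2 ∧ (cluster C p.2).Nonempty
  let hP : DecidablePred P := fun p => inferInstanceAs (Decidable (_ ∧ _))
  let G : V × Fin k → ℝ := fun p => if h : P p then
    ∑ s : Fin q, (if C p.1 = i ∧ p.2 = j then φ (⟨p, h⟩, s) else 0) else 0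
  have key := Finset.sum_subtype (Finset.univ.filter P) (p := P)
    (F := Subtype.fintype fun p : V × Fin k => C p.1 ≤ p.2 ∧ (cluster C p.2).Nonempty)
    (by simp) G
  have hl : ∀ p : {p // P p}, G p =
      ∑ s : Fin q, (if C p.1.1 = i ∧ p.1.2 = j then φ (p, s) else 0) := by
    rintro ⟨p, hp⟩
    simp [G, hp]
  simp only [hl] at key
  refine key.symm.trans ?_
  rw [Finset.sum_filter, Fintype.sum_prod_type, cluster, Finset.sum_filter]
  refine Finset.sum_congr rfl fun u _ => ?_
  rw [Finset.sum_eq_single j]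
  · by_cases hu : C u = i
    · by_cases h : P (u, j)
      · have h' : C u ≤ j ∧ (cluster C j).Nonempty := h
        rw [if_pos h, if_pos hu, dif_pos h']
        simp only [G]
        rw [dif_pos h]
        simp [hu]
      · have h' : ¬ (C u ≤ j ∧ (cluster C j).Nonempty) := h
        rw [if_neg h, if_pos hu, dif_neg h']
    · simp [G, hu]
  · intro b _ hb
    simp [G, hb]
  · simp

theorem sampleBlock_eq_sum {C : Clustering V k} {q : ℕ} (S : Sample C q) (F : V → V → ℝ)
    (i j : Fin k) :
    sampleBlock S F i j = ∑ x : SampleIndex C q,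
      (if C x.1.1.1 = i ∧ x.1.1.2 = j then F x.1.1.1 (S x) else 0) := by
  rw [sum_sampleIndex_ite C q i j (fun x => F x.1.1.1 (S x))]
  rfl

variable [MeasurableSpace V] [DiscreteMeasurableSpace V]

theorem integral_uniformOn (s : Finset V) (hs : s.Nonempty) (φ : V → ℝ) :
    ∫ v, φ v ∂(uniformOn (s : Set V)) = (∑ v ∈ s, φ v) / s.card := by
  classical
  have := isProbabilityMeasure_uniformOn (Ω := V) (Finset.finite_toSet s) (Finset.coe_nonempty.2 hs)
  rw [integral_fintype Integrable.of_finite, Finset.sum_div, ← Finset.sum_subset (Finset.subset_univ s)]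
  · refine Finset.sum_congr rfl fun v hv => ?_
    rw [measureReal_def, ← Finset.coe_singleton, uniformOn_apply_finset,
      Finset.inter_singleton_of_mem hv]
    simp
    ring
  · intro v _ hv
    rw [measureReal_def, ← Finset.coe_singleton, uniformOn_apply_finset,
      Finset.inter_singleton_of_notMem hv]
    simp

/-- From $e^z\le 1+z+z^2$ for $|z|\le1$, together with $y^2\le|y|$ and $1+z\le e^z$. Having the mean
of $|y|$ as the variance term makes the later error proportional to the number of disagreements. -/
theorem integral_exp_uniformOn_le (s : Finset V) (hs : s.Nonempty) (y : V → ℝ)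
    (hy : ∀ v, |y v| ≤ 1) (t : ℝ) (ht : |t| ≤ 1) :
    ∫ v, Real.exp (t * y v) ∂(uniformOn (s : Set V)) ≤
      Real.exp (t * ((∑ v ∈ s, y v) / s.card) + t ^ 2 * ((∑ v ∈ s, |y v|) / s.card)) := by
  have hc : (0 : ℝ) < s.card := by exact_mod_cast hs.card_pos
  have hpt : ∀ v, Real.exp (t * y v) ≤ 1 + t * y v + t ^ 2 * |y v| := by
    intro v
    have h1 : |t * y v| ≤ 1 := by
      rw [abs_mul]; exact mul_le_one₀ ht (abs_nonneg _) (hy v)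
    have h2 := (abs_le.1 (Real.abs_exp_sub_one_sub_id_le h1)).2
    have h3 : y v ^ 2 ≤ |y v| := by
      rw [← sq_abs, sq]
      exact mul_le_of_le_one_left (abs_nonneg _) (hy v)
    have h4 := mul_le_mul_of_nonneg_left h3 (sq_nonneg t)
    rw [mul_pow] at h2
    linarith
  rw [integral_uniformOn s hs]
  have hsum : (∑ v ∈ s, Real.exp (t * y v)) / s.card ≤
      t * ((∑ v ∈ s, y v) / s.card) + t ^ 2 * ((∑ v ∈ s, |y v|) / s.card) + 1 := by
    rw [div_le_iff₀ hc]
    calc ∑ v ∈ s, Real.exp (t * y v) ≤ ∑ v ∈ s, (1 + t * y v + t ^ 2 * |y v|) :=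
          Finset.sum_le_sum fun v _ => hpt v
      _ = _ := by
          simp only [Finset.sum_add_distrib, ← Finset.mul_sum]
          field_simp
          simp
          ring
  exact hsum.trans (Real.add_one_le_exp _)

/-- The moment generating function of a sampled block is at most that of a variable of
Bernstein type. -/
theorem integral_exp_sampleBlock_le (C : Clustering V k) (q : ℕ) (F : V → V → ℝ)
    (hF : ∀ u v, |F u v| ≤ 1) (i j : Fin k) (hij : i ≤ j) (hj : (cluster C j).Nonempty)
    (t : ℝ) (ht : |t| ≤ 1) :
    ∫ S, Real.exp (t * sampleBlock S F i j) ∂(sampleLaw C q) ≤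
      Real.exp (q / (cluster C j).card *
        (t * blockSum C F i j + t ^ 2 * blockSum C (fun u v => |F u v|) i j)) := by
  classical
  -- Draws outside the block receive the factor 1, so the exponential is a product over all
  -- independent draws and its integral factorizes.
  let φ : SampleIndex C q → V → ℝ := fun x v =>
    if C x.1.1.1 = i ∧ x.1.1.2 = j then Real.exp (t * F x.1.1.1 v) else 1
  let e : SampleIndex C q → ℝ := fun x =>
    t * ((∑ v ∈ cluster C j, F x.1.1.1 v) / (cluster C j).card) +
      t ^ 2 * ((∑ v ∈ cluster C j, |F x.1.1.1 v|) / (cluster C j).card)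
  have hprob (x : SampleIndex C q) :
      IsProbabilityMeasure (uniformOn (cluster C x.1.1.2 : Set V)) :=
    isProbabilityMeasure_uniformOn (Finset.finite_toSet _) (Finset.coe_nonempty.2 x.1.2.2)
  have hexp : ∀ S : Sample C q, Real.exp (t * sampleBlock S F i j) = ∏ x, φ x (S x) := by
    intro S
    rw [sampleBlock_eq_sum, Finset.mul_sum, Real.exp_sum]
    refine Finset.prod_congr rfl fun x _ => ?_
    by_cases h : C x.1.1.1 = i ∧ x.1.1.2 = j <;> simp [φ, h]
  have hfac : ∀ x, ∫ v, φ x v ∂(uniformOn (cluster C x.1.1.2 : Set V)) ≤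
      Real.exp (if C x.1.1.1 = i ∧ x.1.1.2 = j then e x else 0) := by
    intro x
    by_cases h : C x.1.1.1 = i ∧ x.1.1.2 = j
    · simp only [φ, e, if_pos h]
      rw [h.2]
      exact integral_exp_uniformOn_le _ hj _ (fun v => hF _ v) t ht
    · have := hprob x
      simp [φ, if_neg h]
  simp only [hexp]
  unfold sampleLaw
  rw [integral_fintype_prod_eq_prod]
  refine (Finset.prod_le_prod (fun x _ => ?_) fun x _ => hfac x).trans ?_
  · refine integral_nonneg fun v => ?_
    simp only [φ]
    split_ifs
    · exact (Real.exp_pos _).le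
    · exact zero_le_one
  rw [← Real.exp_sum, sum_sampleIndex_ite C q i j e]
  refine le_of_eq (congrArg Real.exp ?_)
  rw [blockSum, blockSum, Finset.mul_sum, Finset.mul_sum, ← Finset.sum_add_distrib,
    Finset.mul_sum]
  refine Finset.sum_congr rfl fun u hu => ?_
  have hu' : C u ≤ j ∧ (cluster C j).Nonempty := ⟨(mem_cluster.1 hu).le.trans hij, hj⟩
  rw [dif_pos hu']
  simp only [e, Finset.sum_const, Finset.card_univ, Fintype.card_fin, nsmul_eq_mul]
  ring

theorem measureReal_sampleBlock_ge_le (C : Clustering V k) (q : ℕ) (F : V → V → ℝ)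
    (hF : ∀ u v, |F u v| ≤ 1) (i j : Fin k) (hij : i ≤ j) (hj : (cluster C j).Nonempty)
    {ε : ℝ} (hε : 0 < ε) (hε1 : ε ≤ 1) {T : ℝ}
    (hT : blockSum C (fun u v => |F u v|) i j ≤ T) :
    (sampleLaw C q).real {S | q / (cluster C j).card * (blockSum C F i j + ε * T) ≤
        sampleBlock S F i j} ≤
      Real.exp (-(q / (cluster C j).card * (ε ^ 2 * T / 4))) := by
  -- Chernoff's bound: $t=\varepsilon/2$ minimizes $-t\varepsilon T+t^2T$, with value
  -- $-\varepsilon^2T/4$.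
  have h1 := measure_ge_le_exp_mul_mgf (μ := sampleLaw C q)
    (X := fun S => sampleBlock S F i j) (t := ε / 2)
    (q / (cluster C j).card * (blockSum C F i j + ε * T)) (by positivity) Integrable.of_finite
  have ht : |ε / 2| ≤ 1 := by rw [abs_of_pos (by positivity)]; linarith
  have h2 := integral_exp_sampleBlock_le C q F hF i j hij hj (ε / 2) ht
  refine h1.trans ((mul_le_mul_of_nonneg_left h2 (Real.exp_pos _).le).trans ?_)
  rw [← Real.exp_add]
  refine Real.exp_le_exp.2 ?_
  have h3 : 0 ≤ (q : ℝ) / (cluster C j).card * (ε ^ 2 / 4) *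
      (T - blockSum C (fun u v => |F u v|) i j) :=
    mul_nonneg (by positivity) (sub_nonneg.2 hT)
  nlinarith [h3]

/-- Concentration of a sampled block around the block sum, relative to an upper bound `T` of the
sum of the absolute values over the block. -/
theorem measureReal_sampleBlock_deviation_le (C : Clustering V k) {q : ℕ} (hq : 0 < q)
    (F : V → V → ℝ) (hF : ∀ u v, |F u v| ≤ 1) (i j : Fin k) (hij : i ≤ j)
    (hj : (cluster C j).Nonempty) {ε : ℝ} (hε : 0 < ε) (hε1 : ε ≤ 1) {T : ℝ}
    (hT : blockSum C (fun u v => |F u v|) i j ≤ T) :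
    (sampleLaw C q).real {S | ε * T <
        |(cluster C j).card / q * sampleBlock S F i j - blockSum C F i j|} ≤
      2 * Real.exp (-(q / (cluster C j).card * (ε ^ 2 * T / 4))) := by
  have hc : (0 : ℝ) < (cluster C j).card := by exact_mod_cast hj.card_pos
  have hq' : (0 : ℝ) < q := by exact_mod_cast hq
  have h1 := measureReal_sampleBlock_ge_le C q F hF i j hij hj hε hε1 hT
  have h2 := measureReal_sampleBlock_ge_le C q (fun u v => -F u v) (by simpa using hF) i j hij hj
    hε hε1 (T := T) (by simpa using hT)
  have hneg : blockSum C (fun u v => -F u v) i j = -blockSum C F i j := by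
    simp [blockSum]
  have hneg' : ∀ S : Sample C q, sampleBlock S (fun u v => -F u v) i j = -sampleBlock S F i j := by
    intro S
    simp only [sampleBlock_eq_sum, ← Finset.sum_neg_distrib]
    exact Finset.sum_congr rfl fun x _ => by split_ifs <;> simp
  simp only [hneg, hneg'] at h2
  have hsub : {S : Sample C q | ε * T <
      |(cluster C j).card / q * sampleBlock S F i j - blockSum C F i j|} ⊆
      {S | q / (cluster C j).card * (blockSum C F i j + ε * T) ≤ sampleBlock S F i j} ∪
      {S | q / (cluster C j).card * (-blockSum C F i j + ε * T) ≤ -sampleBlock S F i j} := by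
    intro S hS
    have key : ∀ a R : ℝ, a ≤ (cluster C j).card / q * R → q / (cluster C j).card * a ≤ R := by
      intro a R h
      have := mul_le_mul_of_nonneg_left h (by positivity : (0 : ℝ) ≤ q / (cluster C j).card)
      rwa [← mul_assoc, div_mul_div_cancel₀ hc.ne', div_self hq'.ne', one_mul] at this
    rcases lt_abs.1 (Set.mem_ofPred.1 hS) with h | h
    · exact Or.inl (key _ _ (by linarith))
    · exact Or.inr (key _ _ (by linarith))
  calc _ ≤ _ := measureReal_mono hsub
    _ ≤ _ := measureReal_union_le _ _
    _ ≤ _ := by linarith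

/-- The type of samples allows draws outside the prescribed cluster. Discarding this null set is
what lets a sampled block depend only on the values of $\mathcal C'$ on $C_i\cup C_j$. -/
theorem ae_sample_mem_cluster (C : Clustering V k) (q : ℕ) :
    ∀ᵐ S ∂(sampleLaw C q), ∀ x : SampleIndex C q, C (S x) = x.1.1.2 := by
  have hprob (x : SampleIndex C q) :
      IsProbabilityMeasure (uniformOn (cluster C x.1.1.2 : Set V)) :=
    isProbabilityMeasure_uniformOn (Finset.finite_toSet _) (Finset.coe_nonempty.2 x.1.2.2)
  refine ae_all_iff.2 fun x => ?_
  unfold sampleLaw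
  refine Measure.tendsto_eval_ae_ae.eventually (p := fun v => C v = x.1.1.2) ?_
  rw [ae_iff, uniformOn_eq_zero_iff (Finset.finite_toSet _)]
  ext v
  simp [mem_cluster]

end Sampling

/-! ### Block decomposition of sums over pairs, and the majorants. -/

section Blocks

variable {V : Type*} [Fintype V] {k : ℕ}

theorem half_sum_sum_eq_of_symm (b : Fin k → Fin k → ℝ) (hb : ∀ i j, b i j = b j i) :
    (1 / 2) * ∑ i, ∑ j, b i j = (1 / 2) * ∑ i, b i i + ∑ i, ∑ j ∈ Finset.Ioi i, b i j := by
  have hsplit : ∀ i, ∑ j, b i j =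
      b i i + ∑ j ∈ Finset.Ioi i, b i j + ∑ j, (if j < i then b i j else 0) := by
    intro i
    have h1 : ∑ j ∈ Finset.Ioi i, b i j = ∑ j, (if i < j then b i j else 0) := by
      rw [← Finset.sum_filter]
      congr 1
      ext j
      simp
    have h2 : b i i = ∑ j, (if j = i then b i j else 0) := by simp
    rw [h1, h2, ← Finset.sum_add_distrib, ← Finset.sum_add_distrib]
    refine Finset.sum_congr rfl fun j _ => ?_
    rcases lt_trichotomy i j with h | h | h
    · simp [h, h.ne', h.not_gt]
    · simp [h]
    · simp [h, h.ne, h.not_gt]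
  have hswap : ∑ i, ∑ j, (if j < i then b i j else 0) = ∑ i, ∑ j ∈ Finset.Ioi i, b i j := by
    rw [Finset.sum_comm]
    refine Finset.sum_congr rfl fun i _ => ?_
    rw [← Finset.sum_filter]
    refine Finset.sum_congr (by ext j; simp) fun j _ => hb j i
  simp only [hsplit, Finset.sum_add_distrib, hswap]
  ring

theorem sum_sum_eq_sum_blockSum (C : Clustering V k) (F : V → V → ℝ) :
    ∑ u, ∑ v, F u v = ∑ i, ∑ j, blockSum C F i j := by
  have h : ∀ g : V → ℝ, ∑ v, g v = ∑ i, ∑ v ∈ cluster C i, g v := fun g =>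
    (Finset.sum_fiberwise Finset.univ C g).symm
  rw [h]
  refine Finset.sum_congr rfl fun i _ => ?_
  unfold blockSum
  rw [Finset.sum_comm (s := Finset.univ (α := Fin k))]
  exact Finset.sum_congr rfl fun u _ => h (F u)

theorem blockSum_comm (C : Clustering V k) {F : V → V → ℝ} (hF : ∀ u v, F u v = F v u)
    (i j : Fin k) : blockSum C F i j = blockSum C F j i := by
  unfold blockSum
  rw [Finset.sum_comm]
  exact Finset.sum_congr rfl fun u _ => Finset.sum_congr rfl fun v _ => hF _ _

theorem half_sum_sum_eq_blockSum (C : Clustering V k) {F : V → V → ℝ}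
    (hF : ∀ u v, F u v = F v u) :
    (1 / 2) * ∑ u, ∑ v, F u v =
      (1 / 2) * ∑ i, blockSum C F i i + ∑ i, ∑ j ∈ Finset.Ioi i, blockSum C F i j := by
  rw [sum_sum_eq_sum_blockSum C F]
  exact half_sum_sum_eq_of_symm _ (blockSum_comm C hF)

theorem blockSum_nonneg (C : Clustering V k) {F : V → V → ℝ} (hF : ∀ u v, 0 ≤ F u v)
    (i j : Fin k) : 0 ≤ blockSum C F i j :=
  Finset.sum_nonneg fun _ _ => Finset.sum_nonneg fun _ _ => hF _ _

theorem blockSum_congr (C : Clustering V k) {F F' : V → V → ℝ} {i j : Fin k}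
    (h : ∀ u v, C u = i → C v = j → F u v = F' u v) : blockSum C F i j = blockSum C F' i j :=
  Finset.sum_congr rfl fun u hu => Finset.sum_congr rfl fun v hv =>
    h u v (mem_cluster.1 hu) (mem_cluster.1 hv)

theorem sampleBlock_congr {C : Clustering V k} {q : ℕ} {S : Sample C q}
    (hS : ∀ x : SampleIndex C q, C (S x) = x.1.1.2) {F F' : V → V → ℝ} {i j : Fin k}
    (h : ∀ u v, C u = i → C v = j → F u v = F' u v) :
    sampleBlock S F i j = sampleBlock S F' i j := by
  rw [sampleBlock_eq_sum, sampleBlock_eq_sum]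
  refine Finset.sum_congr rfl fun x _ => ?_
  split_ifs with hx
  · exact h _ _ hx.1 ((hS x).trans hx.2)
  · rfl

/-- The sum of `D` over the block `(i, j)`, enlarged by the share that this block receives of the
sums over the two diagonal blocks. -/
noncomputable def blockMajorant (C : Clustering V k) (D : V → V → ℝ) (i j : Fin k) : ℝ :=
  blockSum C D i j + (blockSum C D i i + blockSum C D j j) / (2 * k)

theorem blockSum_le_blockMajorant (C : Clustering V k) {D : V → V → ℝ} (hD : ∀ u v, 0 ≤ D u v)
    (i j : Fin k) : blockSum C D i j ≤ blockMajorant C D i j :=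
  le_add_of_nonneg_right (div_nonneg
    (add_nonneg (blockSum_nonneg C hD i i) (blockSum_nonneg C hD j j)) (by positivity))

theorem blockMajorant_nonneg (C : Clustering V k) {D : V → V → ℝ} (hD : ∀ u v, 0 ≤ D u v)
    (i j : Fin k) : 0 ≤ blockMajorant C D i j :=
  (blockSum_nonneg C hD i j).trans (blockSum_le_blockMajorant C hD i j)

/-- Over all ordered pairs $(i,j)$ each diagonal sum is counted $2k$ times with weight $1/(2k)$. The
majorants thus add one extra copy of the diagonal, which is at most the whole sum. -/
theorem sum_blockMajorant_le (C : Clustering V k) {D : V → V → ℝ} (hD : ∀ u v, 0 ≤ D u v)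
    (hs : ∀ u v, D u v = D v u) :
    (1 / 2) * ∑ i, blockMajorant C D i i + ∑ i, ∑ j ∈ Finset.Ioi i, blockMajorant C D i j ≤
      2 * ((1 / 2) * ∑ u, ∑ v, D u v) := by
  have h1 := half_sum_sum_eq_of_symm (blockMajorant C D) (fun i j => by
    rw [blockMajorant, blockMajorant, blockSum_comm C hs i j, add_comm (blockSum C D i i)])
  have h2 := half_sum_sum_eq_blockSum C hs
  have h3 : ∑ i, ∑ j, blockMajorant C D i j ≤
      ∑ u, ∑ v, D u v + ∑ i, blockSum C D i i := by
    rw [sum_sum_eq_sum_blockSum C D]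
    simp only [blockMajorant, Finset.sum_add_distrib, ← Finset.sum_div, Finset.sum_const,
      Finset.card_univ, Fintype.card_fin, nsmul_eq_mul, ← Finset.mul_sum]
    refine add_le_add_right ?_ _
    rcases k.eq_zero_or_pos with rfl | hk
    · simp
    · have : (0 : ℝ) < k := by exact_mod_cast hk
      refine le_of_eq ?_
      field_simp
      ring
  have h4 : 0 ≤ ∑ i, ∑ j ∈ Finset.Ioi i, blockSum C D i j :=
    Finset.sum_nonneg fun _ _ => Finset.sum_nonneg fun _ _ => blockSum_nonneg C hD _ _
  linarith

end Blocks

/-! ### Regret, relative error, and clusterings close to two labels on a block. -/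

section Regret

variable {V : Type*} {k : ℕ} (G : SimpleGraph V) [DecidableRel G.Adj]

theorem pairRegret_comm (C C' : Clustering V k) (u v : V) :
    pairRegret G C C' u v = pairRegret G C C' v u := by
  simp only [pairRegret, pairCost, G.adj_comm u v, eq_comm (a := C u), eq_comm (a := C' u)]

theorem abs_pairRegret (C C' : Clustering V k) (u v : V) :
    |pairRegret G C C' u v| = if (C u = C v ↔ C' u = C' v) then 0 else 1 := by
  by_cases h1 : G.Adj u v <;> by_cases h2 : C u = C v <;> by_cases h3 : C' u = C' v <;>
    simp [pairRegret, pairCost, h1, h2, h3]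

theorem abs_pairRegret_le_one (C C' : Clustering V k) (u v : V) :
    |pairRegret G C C' u v| ≤ 1 := by
  rw [abs_pairRegret]
  split_ifs <;> norm_num

theorem pairRegret_congr (C : Clustering V k) {C' C'' : Clustering V k} {u v : V}
    (hu : C' u = C'' u) (hv : C' v = C'' v) :
    pairRegret G C C' u v = pairRegret G C C'' u v := by
  simp only [pairRegret, pairCost, hu, hv]

variable [Fintype V]

theorem dist_eq (C C' : Clustering V k) :
    dist C C' = (1 / 2) * ∑ u, ∑ v, |pairRegret G C C' u v| := by
  unfold dist
  congr 1
  refine Finset.sum_congr rfl fun u _ => Finset.sum_congr rfl fun v _ => ?_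
  rw [abs_pairRegret]
  by_cases h2 : C u = C v <;> by_cases h3 : C' u = C' v <;> simp [h2, h3]

theorem regret_eq [DecidableEq V] (C C' : Clustering V k) :
    regret G C C' = (1 / 2) * ∑ u, ∑ v, pairRegret G C C' u v := by
  unfold regret cost
  rw [← mul_sub, ← Finset.sum_sub_distrib]
  congr 1
  refine Finset.sum_congr rfl fun u _ => ?_
  rw [← Finset.sum_sub_distrib, Finset.sum_filter]
  refine Finset.sum_congr rfl fun v _ => ?_
  by_cases h : v = u
  · simp [h, pairRegret, pairCost]
  · simp [h, pairRegret]

theorem estimator_eq {C : Clustering V k} {q : ℕ} (S : Sample C q) (C' : Clustering V k) :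
    estimator G C S C' =
      (1 / 2) * ∑ i, (cluster C i).card / q * sampleBlock S (pairRegret G C C') i i
      + ∑ i, ∑ j ∈ Finset.Ioi i,
          (cluster C j).card / q * sampleBlock S (pairRegret G C C') i j := by
  unfold estimator
  congr 1
  refine Finset.sum_congr rfl fun i _ => ?_
  rw [Finset.sum_comm]
  exact Finset.sum_congr rfl fun j _ => (Finset.mul_sum _ _ _).symm

/-- An error bound on every block gives a relative error bound on the regret. -/
theorem abs_regret_sub_estimator_le [DecidableEq V] {C : Clustering V k} {q : ℕ} (S : Sample C q)
    (C' : Clustering V k) (ε : ℝ) (hε : 0 ≤ ε)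
    (h : ∀ i j, i ≤ j → (cluster C j).Nonempty →
      |(cluster C j).card / q * sampleBlock S (pairRegret G C C') i j -
        blockSum C (pairRegret G C C') i j| ≤
      ε * blockMajorant C (fun u v => |pairRegret G C C' u v|) i j) :
    |regret G C C' - estimator G C S C'| ≤ 2 * ε * dist C C' := by
  have hD : ∀ u v, 0 ≤ |pairRegret G C C' u v| := fun _ _ => abs_nonneg _
  have h' : ∀ i j, i ≤ j →
      |blockSum C (pairRegret G C C') i j -
        (cluster C j).card / q * sampleBlock S (pairRegret G C C') i j| ≤
      ε * blockMajorant C (fun u v => |pairRegret G C C' u v|) i j := by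
    intro i j hij
    by_cases hj : (cluster C j).Nonempty
    · rw [abs_sub_comm]
      exact h i j hij hj
    · rw [Finset.not_nonempty_iff_eq_empty] at hj
      have h0 : blockSum C (pairRegret G C C') i j = 0 := by simp [blockSum, hj]
      rw [h0, hj]
      simpa using mul_nonneg hε (blockMajorant_nonneg C hD i j)
  rw [regret_eq, half_sum_sum_eq_blockSum C (pairRegret_comm G C C'), estimator_eq,
    add_sub_add_comm, ← mul_sub, ← Finset.sum_sub_distrib, ← Finset.sum_sub_distrib]
  simp only [← Finset.sum_sub_distrib]
  refine (abs_add_le _ _).trans ?_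
  have hsum := sum_blockMajorant_le C hD (fun u v => by rw [pairRegret_comm G C C'])
  rw [← dist_eq] at hsum
  have hsum' := mul_le_mul_of_nonneg_left hsum hε
  refine le_trans (add_le_add (b := (1 / 2) *
    ∑ i, ε * blockMajorant C (fun u v => |pairRegret G C C' u v|) i i)
    (d := ∑ i, ∑ j ∈ Finset.Ioi i,
      ε * blockMajorant C (fun u v => |pairRegret G C C' u v|) i j) ?_ ?_) ?_
  · rw [abs_mul, abs_of_pos (by norm_num : (0 : ℝ) < 1 / 2)]
    refine mul_le_mul_of_nonneg_left ?_ (by norm_num)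
    exact (Finset.abs_sum_le_sum_abs _ _).trans (Finset.sum_le_sum fun i _ => h' i i le_rfl)
  · refine (Finset.abs_sum_le_sum_abs _ _).trans (Finset.sum_le_sum fun i _ => ?_)
    exact (Finset.abs_sum_le_sum_abs _ _).trans
      (Finset.sum_le_sum fun j hj => h' i j (Finset.mem_Ioi.1 hj).le)
  · simp only [← Finset.mul_sum]
    linarith

/-- A most frequent label on a cluster: the points of the cluster with another label are charged
to the pairs within the cluster on which the clusterings disagree. -/
theorem exists_plurality_label (C C' : Clustering V k) (i : Fin k) :
    ∃ l : Fin k, ((cluster C i).card : ℝ) * ((cluster C i).filter fun v => C' v ≠ l).card ≤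
      blockSum C (fun u v => |pairRegret G C C' u v|) i i := by
  obtain ⟨l, -, hl⟩ := Finset.exists_min_image Finset.univ
    (fun l => ((cluster C i).filter fun v => C' v ≠ l).card) ⟨i, Finset.mem_univ i⟩
  refine ⟨l, ?_⟩
  unfold blockSum
  rw [← nsmul_eq_mul, ← Finset.sum_const]
  refine Finset.sum_le_sum fun u hu => ?_
  -- Each row of the diagonal block is one of the counts minimized by `l`, namely the one for the
  -- label `C' u`.
  have h1 : ∑ v ∈ cluster C i, |pairRegret G C C' u v| =
      ((cluster C i).filter fun v => C' v ≠ C' u).card := by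
    rw [Finset.card_filter, Nat.cast_sum]
    refine Finset.sum_congr rfl fun v hv => ?_
    rw [abs_pairRegret, mem_cluster.1 hu, mem_cluster.1 hv]
    by_cases h : C' u = C' v
    · simp [h]
    · simp [h, Ne.symm h]
  rw [h1]
  exact_mod_cast hl (C' u) (Finset.mem_univ _)

/-- The clustering that gives the label `a` to the points of the cluster `i` of `C` and the label
`b` to all other points. -/
def twoLabel (C : Clustering V k) (i a b : Fin k) : Clustering V k :=
  fun v => if C v = i then a else b

/-- With `a` and `b` plurality labels on the two clusters, the deviating points are paid for by the
diagonal part of the majorant, at a price of at least $|C_j|$ each because $|C_i|\ge|C_j|$. The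
summand 1 will leave a factor $x$ in the failure probability even when no point deviates. -/
theorem exists_twoLabel_card_le (C C' : Clustering V k) {i j : Fin k}
    (hcard : (cluster C j).card ≤ (cluster C i).card)
    (hpos : 0 < blockSum C (fun u v => |pairRegret G C C' u v|) i j) :
    ∃ a b : Fin k, ((cluster C j).card : ℝ) *
      (1 + (Finset.univ.filter fun v => (C v = i ∨ C v = j) ∧ C' v ≠ twoLabel C i a b v).card) ≤
      4 * k * blockMajorant C (fun u v => |pairRegret G C C' u v|) i j := by
  classical
  obtain ⟨a, ha⟩ := exists_plurality_label G C C' i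
  obtain ⟨b, hb⟩ := exists_plurality_label G C C' j
  refine ⟨a, b, ?_⟩
  have hD : ∀ u v, 0 ≤ |pairRegret G C C' u v| := fun _ _ => abs_nonneg _
  have hk : (1 : ℝ) ≤ k := by exact_mod_cast i.pos
  set N := Finset.univ.filter fun v => (C v = i ∨ C v = j) ∧ C' v ≠ twoLabel C i a b v with hN
  set M := blockMajorant C (fun u v => |pairRegret G C C' u v|) i j with hM
  have hM0 : 0 ≤ M := blockMajorant_nonneg C hD i j
  have hNle : (N.card : ℝ) ≤ ((cluster C i).filter fun v => C' v ≠ a).card +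
      ((cluster C j).filter fun v => C' v ≠ b).card := by
    have : N ⊆ ((cluster C i).filter fun v => C' v ≠ a) ∪
        ((cluster C j).filter fun v => C' v ≠ b) := by
      intro v hv
      replace hv := (Finset.mem_filter.1 hv).2
      simp only [twoLabel] at hv
      simp only [Finset.mem_union, Finset.mem_filter, mem_cluster]
      by_cases h : C v = i
      · exact Or.inl ⟨h, by simpa [h] using hv.2⟩
      · exact Or.inr ⟨hv.1.resolve_left h, by simpa [h] using hv.2⟩
    exact_mod_cast (Finset.card_le_card this).trans (Finset.card_union_le _ _)
  have hcard' : ((cluster C j).card : ℝ) ≤ (cluster C i).card := by exact_mod_cast hcard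
  have hdiag : blockSum C (fun u v => |pairRegret G C C' u v|) i i +
      blockSum C (fun u v => |pairRegret G C C' u v|) j j ≤ 2 * k * M := by
    have h0 := blockSum_nonneg C hD i j
    have : 2 * k * M = 2 * k * blockSum C (fun u v => |pairRegret G C C' u v|) i j +
        (blockSum C (fun u v => |pairRegret G C C' u v|) i i +
          blockSum C (fun u v => |pairRegret G C C' u v|) j j) := by
      rw [hM, blockMajorant]
      field_simp
    rw [this]
    exact le_add_of_nonneg_left (by positivity)
  have hmoved : ((cluster C j).card : ℝ) * N.card ≤ 2 * k * M := by
    refine le_trans ?_ hdiag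
    calc ((cluster C j).card : ℝ) * N.card ≤ (cluster C j).card *
          (((cluster C i).filter fun v => C' v ≠ a).card +
            ((cluster C j).filter fun v => C' v ≠ b).card) := by gcongr
      _ ≤ (cluster C i).card * ((cluster C i).filter fun v => C' v ≠ a).card +
          (cluster C j).card * ((cluster C j).filter fun v => C' v ≠ b).card := by
        rw [mul_add]; gcongr
      _ ≤ _ := add_le_add ha hb
  -- One deviating point already pays $|C_j|$. With none, a disagreement in the block forces $i\ne
  -- j$ and `a = b`: the two clusters are merged, and every pair of the block disagrees.
  have hbase : ((cluster C j).card : ℝ) ≤ 2 * k * M := by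
    rcases N.card.eq_zero_or_pos with h0 | h1
    · have hlab : ∀ v, C v = i ∨ C v = j → C' v = twoLabel C i a b v := by
        intro v hv
        by_contra hne
        have : v ∈ N := by simp [hN, hv, hne]
        rw [Finset.card_eq_zero.1 h0] at this
        simp at this
      obtain ⟨u, hu, v, hv, huv⟩ : ∃ u ∈ cluster C i, ∃ v ∈ cluster C j,
          |pairRegret G C C' u v| ≠ 0 := by
        by_contra! hall
        exact hpos.ne' (Finset.sum_eq_zero fun u hu => Finset.sum_eq_zero fun v hv => hall u hu v hv)
      have hu' := mem_cluster.1 hu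
      have hv' := mem_cluster.1 hv
      have hlu := hlab u (Or.inl hu')
      have hlv := hlab v (Or.inr hv')
      rw [abs_pairRegret] at huv
      have hne : i ≠ j := by
        rintro rfl
        simp [hlu, hlv, hu', hv', twoLabel] at huv
      have hab : a = b := by
        by_contra hab
        simp [hlu, hlv, hu', hv', twoLabel, hne, hne.symm, hab] at huv
      have hsum : ((cluster C j).card : ℝ) ≤
          blockSum C (fun u v => |pairRegret G C C' u v|) i j := by
        have h1 : ((cluster C j).card : ℝ) = ∑ w ∈ cluster C j, |pairRegret G C C' u w| := by
          rw [Finset.card_eq_sum_ones, Nat.cast_sum]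
          refine Finset.sum_congr rfl fun w hw => ?_
          have hw' := mem_cluster.1 hw
          simp [abs_pairRegret, hlu, hlab w (Or.inr hw'), twoLabel, hu', hw', hne, hab]
        rw [h1]
        exact Finset.single_le_sum (f := fun u => ∑ w ∈ cluster C j, |pairRegret G C C' u w|)
          (fun _ _ => Finset.sum_nonneg fun _ _ => abs_nonneg _) hu
      have h2 := hsum.trans (blockSum_le_blockMajorant C hD i j)
      rw [← hM] at h2
      nlinarith
    · refine le_trans ?_ hmoved
      have : (1 : ℝ) ≤ N.card := by exact_mod_cast h1
      exact le_mul_of_one_le_right (by positivity) this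
  linarith

end Regret

/-! ### Union bound over clusterings, labels and blocks. -/

section Union

variable {V : Type*} [Fintype V] {k : ℕ}

/-- The weight is a product over points, so the sum factorizes; each point contributes $1+(k-1)x$.
-/
theorem sum_pow_card_ne_le [DecidableEq V] (h : V → Fin k) {x : ℝ} (hx : 0 ≤ x) :
    ∑ g : V → Fin k, x ^ (Finset.univ.filter fun v => g v ≠ h v).card ≤
      (1 + k * x) ^ Fintype.card V := by
  have h1 : ∀ g : V → Fin k, x ^ (Finset.univ.filter fun v => g v ≠ h v).card =
      ∏ v, (if g v ≠ h v then x else 1) := by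
    intro g
    rw [Finset.prod_ite]
    simp
  simp only [h1]
  rw [← Fintype.piFinset_univ,
    ← Finset.prod_univ_sum (fun _ => Finset.univ) (fun v c => if c ≠ h v then x else 1),
    ← Finset.card_univ, ← Finset.prod_const]
  refine Finset.prod_le_prod (fun v _ => Finset.sum_nonneg fun c _ => ?_) fun v _ => ?_
  · split_ifs <;> positivity
  · calc ∑ c, (if c ≠ h v then x else 1) ≤ ∑ c, ((if c = h v then 1 else 0) + x) := by
          refine Finset.sum_le_sum fun c _ => ?_
          by_cases hc : c = h v <;> simp [hc, hx]
      _ = _ := by simp [Finset.sum_add_distrib]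

variable (G : SimpleGraph V) [DecidableRel G.Adj]

/-- The samples whose draws from the block `(i, j)` miss the regret of `C'` on that block by more
than `ε` times the majorant of the block. -/
def badSamples (C : Clustering V k) (q : ℕ) (ε : ℝ) (i j : Fin k) (C' : Clustering V k) :
    Set (Sample C q) :=
  {S | ε * blockMajorant C (fun u v => |pairRegret G C C' u v|) i j <
    |(cluster C j).card / q * sampleBlock S (pairRegret G C C') i j -
      blockSum C (pairRegret G C C') i j|}

/-- A clustering that is bad on the block `(i, j)` can be replaced by one that uses only one label
outside the two clusters of the block, and differs from a two-label clustering in few points. -/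
theorem exists_mem_badSamples_twoLabel {C : Clustering V k} {q : ℕ} {ε : ℝ} (hε : 0 ≤ ε)
    {i j : Fin k} (hcard : (cluster C j).card ≤ (cluster C i).card) {S : Sample C q}
    (hS : ∀ x : SampleIndex C q, C (S x) = x.1.1.2) {C' : Clustering V k}
    (hbad : S ∈ badSamples G C q ε i j C') :
    ∃ (a b : Fin k) (g : Clustering V k), S ∈ badSamples G C q ε i j g ∧
      ((cluster C j).card : ℝ) *
        (1 + (Finset.univ.filter fun v => g v ≠ twoLabel C i a b v).card) ≤
      4 * k * blockMajorant C (fun u v => |pairRegret G C g u v|) i j := by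
  have hD : ∀ u v, 0 ≤ |pairRegret G C C' u v| := fun _ _ => abs_nonneg _
  -- Without a disagreement in the block, both the block sum and its sampled version vanish, so the
  -- error is zero and the sample is not bad.
  have hpos : 0 < blockSum C (fun u v => |pairRegret G C C' u v|) i j := by
    refine lt_of_le_of_ne (blockSum_nonneg C hD i j) fun h0 => ?_
    have hz : ∀ u v, C u = i → C v = j → pairRegret G C C' u v = 0 := by
      intro u v hu hv
      have h1 := (Finset.sum_eq_zero_iff_of_nonneg
        (fun u _ => Finset.sum_nonneg fun v _ => hD u v)).1 h0.symm u (mem_cluster.2 hu)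
      exact abs_eq_zero.1
        ((Finset.sum_eq_zero_iff_of_nonneg fun v _ => hD u v).1 h1 v (mem_cluster.2 hv))
    have hA : blockSum C (pairRegret G C C') i j = 0 := by
      rw [blockSum_congr C (F' := fun _ _ => 0) hz]
      simp [blockSum]
    have hR : sampleBlock S (pairRegret G C C') i j = 0 := by
      rw [sampleBlock_congr hS (F' := fun _ _ => 0) hz]
      simp [sampleBlock_eq_sum]
    have := Set.mem_ofPred.1 hbad
    rw [hA, hR, mul_zero, sub_zero, abs_zero] at this
    exact this.not_ge (mul_nonneg hε (blockMajorant_nonneg C hD i j))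
  obtain ⟨a, b, hab⟩ := exists_twoLabel_card_le G C C' hcard hpos
  -- Relabelling off the two clusters changes neither the error nor the majorant. The label `b` is
  -- the one `twoLabel` uses there, so no new deviation arises.
  let g : Clustering V k := fun v => if C v = i ∨ C v = j then C' v else b
  have hg : ∀ v, C v = i ∨ C v = j → g v = C' v := fun v hv => if_pos hv
  have hf : ∀ u v, (C u = i ∨ C u = j) → (C v = i ∨ C v = j) →
      pairRegret G C g u v = pairRegret G C C' u v := fun u v hu hv =>
    pairRegret_congr G C (hg u hu) (hg v hv)
  have hM : blockMajorant C (fun u v => |pairRegret G C g u v|) i j =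
      blockMajorant C (fun u v => |pairRegret G C C' u v|) i j := by
    unfold blockMajorant
    congr 1
    · exact blockSum_congr C fun u v hu hv => congrArg _ (hf u v (Or.inl hu) (Or.inr hv))
    congr 2
    · exact blockSum_congr C fun u v hu hv => congrArg _ (hf u v (Or.inl hu) (Or.inl hv))
    · exact blockSum_congr C fun u v hu hv => congrArg _ (hf u v (Or.inr hu) (Or.inr hv))
  have hij : ∀ u v, C u = i → C v = j → pairRegret G C g u v = pairRegret G C C' u v :=
    fun u v hu hv => hf u v (Or.inl hu) (Or.inr hv)
  refine ⟨a, b, g, ?_, ?_⟩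
  · unfold badSamples
    rw [Set.mem_ofPred, hM, blockSum_congr C hij, sampleBlock_congr hS hij]
    exact hbad
  · rw [hM]
    convert hab using 6 with v
    by_cases hv : C v = i ∨ C v = j
    · simp [hv, hg v hv]
    · have h1 : C v ≠ i := fun h => hv (Or.inl h)
      simp [g, twoLabel, h1]

variable [MeasurableSpace V] [DiscreteMeasurableSpace V]

theorem measureReal_badSamples_le {C : Clustering V k} {q : ℕ} (hq : 0 < q) {ε : ℝ} (hε : 0 < ε)
    (hε1 : ε ≤ 1) {i j : Fin k} (hij : i ≤ j) (hj : (cluster C j).Nonempty) (g : Clustering V k)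
    (m : ℕ) (hm : ((cluster C j).card : ℝ) * (1 + m) ≤
      4 * k * blockMajorant C (fun u v => |pairRegret G C g u v|) i j) :
    (sampleLaw C q).real (badSamples G C q ε i j g) ≤
      2 * (Real.exp (-(q * ε ^ 2 / (16 * k))) * Real.exp (-(q * ε ^ 2 / (16 * k))) ^ m) := by
  have hk : (0 : ℝ) < k := by exact_mod_cast i.pos
  have hc : (0 : ℝ) < (cluster C j).card := by exact_mod_cast hj.card_pos
  refine (measureReal_sampleBlock_deviation_le C hq (pairRegret G C g)
    (abs_pairRegret_le_one G C g) i j hij hj hε hε1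
    (blockSum_le_blockMajorant C (fun _ _ => abs_nonneg _) i j)).trans ?_
  rw [← Real.exp_nat_mul, ← Real.exp_add]
  refine mul_le_mul_of_nonneg_left (Real.exp_le_exp.2 ?_) zero_le_two
  set M := blockMajorant C (fun u v => |pairRegret G C g u v|) i j
  have h1 : q * ε ^ 2 / (16 * k) * (1 + m) ≤ q / (cluster C j).card * (ε ^ 2 * M / 4) := by
    rw [div_mul_eq_mul_div, div_mul_eq_mul_div, div_le_div_iff₀ (by positivity) hc]
    have := mul_le_mul_of_nonneg_left hm (by positivity : 0 ≤ q * ε ^ 2)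
    nlinarith
  linarith

/-- Up to a null set, it suffices to unite over the pairs `(a, b)`, whence $k^2$, and the
clusterings satisfying the deviation bound, each failing with probability at most $2x^{1+m}$. -/
theorem measureReal_iUnion_badSamples_le {C : Clustering V k}
    (hC : Antitone fun j : Fin k => (cluster C j).card) {q : ℕ} (hq : 0 < q) {ε : ℝ} (hε : 0 < ε)
    (hε1 : ε ≤ 1) {i j : Fin k} (hij : i ≤ j) (hj : (cluster C j).Nonempty) :
    (sampleLaw C q).real (⋃ C', badSamples G C q ε i j C') ≤
      k ^ 2 * (2 * Real.exp (-(q * ε ^ 2 / (16 * k))) *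
        (1 + k * Real.exp (-(q * ε ^ 2 / (16 * k)))) ^ Fintype.card V) := by
  classical
  set x := Real.exp (-(q * ε ^ 2 / (16 * k))) with hx
  have hx0 : 0 ≤ x := (Real.exp_pos _).le
  let m : Fin k × Fin k → Clustering V k → ℕ := fun p g =>
    (Finset.univ.filter fun v => g v ≠ twoLabel C i p.1 p.2 v).card
  let L : Fin k × Fin k → Finset (Clustering V k) := fun p => Finset.univ.filter fun g =>
    ((cluster C j).card : ℝ) * (1 + m p g) ≤
      4 * k * blockMajorant C (fun u v => |pairRegret G C g u v|) i j
  have hle : (⋃ C', badSamples G C q ε i j C') ≤ᵐ[sampleLaw C q]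
      (⋃ p, ⋃ g ∈ L p, badSamples G C q ε i j g : Set (Sample C q)) := by
    filter_upwards [ae_sample_mem_cluster C q] with S hS hbad
    obtain ⟨C', hC'⟩ := Set.mem_iUnion.1 hbad
    obtain ⟨a, b, g, hg, hm⟩ := exists_mem_badSamples_twoLabel G hε.le (hC hij) hS hC'
    exact Set.mem_iUnion.2 ⟨(a, b), Set.mem_iUnion₂.2 ⟨g, by simpa [L, m] using hm, hg⟩⟩
  have hmono : (sampleLaw C q).real (⋃ C', badSamples G C q ε i j C') ≤
      (sampleLaw C q).real (⋃ p, ⋃ g ∈ L p, badSamples G C q ε i j g) :=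
    ENNReal.toReal_mono (measure_ne_top _ _) (measure_mono_ae hle)
  refine hmono.trans ((measureReal_iUnion_fintype_le _).trans ?_)
  have hp : ∀ p : Fin k × Fin k, (sampleLaw C q).real (⋃ g ∈ L p, badSamples G C q ε i j g) ≤
      2 * x * (1 + k * x) ^ Fintype.card V := by
    intro p
    calc (sampleLaw C q).real (⋃ g ∈ L p, badSamples G C q ε i j g)
        ≤ ∑ g ∈ L p, (sampleLaw C q).real (badSamples G C q ε i j g) :=
          measureReal_biUnion_finset_le _ _
      _ ≤ ∑ g ∈ L p, 2 * (x * x ^ m p g) := Finset.sum_le_sum fun g hg =>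
          measureReal_badSamples_le G hq hε hε1 hij hj g _ (Finset.mem_filter.1 hg).2
      -- The restriction to `L p` has served its purpose; the sum over all clusterings factorizes.
      _ ≤ ∑ g, 2 * (x * x ^ m p g) :=
          Finset.sum_le_sum_of_subset_of_nonneg (Finset.subset_univ _) fun _ _ _ => by positivity
      _ = 2 * x * ∑ g, x ^ m p g := by
          rw [Finset.mul_sum]
          exact Finset.sum_congr rfl fun _ _ => by ring
      _ ≤ _ := mul_le_mul_of_nonneg_left (sum_pow_card_ne_le _ hx0) (by positivity)
  refine (Finset.sum_le_sum fun p _ => hp p).trans (le_of_eq ?_)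
  simp [sq]

theorem one_sub_le_measureReal_isSmoothRegretApprox [DecidableEq V] {C : Clustering V k}
    (hC : Antitone fun j : Fin k => (cluster C j).card) {q : ℕ} (hq : 0 < q) {ε : ℝ} (hε : 0 < ε)
    (hε1 : ε ≤ 1) :
    1 - k ^ 4 * (2 * Real.exp (-(q * ε ^ 2 / (16 * k))) *
        (1 + k * Real.exp (-(q * ε ^ 2 / (16 * k)))) ^ Fintype.card V) ≤
      (sampleLaw C q).real {S | IsSmoothRegretApprox G (2 * ε) C (estimator G C S)} := by
  classical
  set B := 2 * Real.exp (-(q * ε ^ 2 / (16 * k))) *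
        (1 + k * Real.exp (-(q * ε ^ 2 / (16 * k)))) ^ Fintype.card V with hB
  have hB0 : 0 ≤ B := by positivity
  let bad : Fin k × Fin k → Set (Sample C q) := fun p =>
    if p.1 ≤ p.2 ∧ (cluster C p.2).Nonempty then ⋃ C', badSamples G C q ε p.1 p.2 C' else ∅
  have hbad : ∀ p, (sampleLaw C q).real (bad p) ≤ k ^ 2 * B := by
    intro p
    by_cases h : p.1 ≤ p.2 ∧ (cluster C p.2).Nonempty
    · simp only [bad, if_pos h]
      exact measureReal_iUnion_badSamples_le G hC hq hε hε1 h.1 h.2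
    · simp only [bad, if_neg h, measureReal_empty]
      positivity
  have hcover : (Set.univ : Set (Sample C q)) ⊆
      {S | IsSmoothRegretApprox G (2 * ε) C (estimator G C S)} ∪ ⋃ p, bad p := by
    intro S _
    by_cases hS : S ∈ ⋃ p, bad p
    · exact Or.inr hS
    · refine Or.inl fun C' => abs_regret_sub_estimator_le G S C' ε hε.le fun i j hij hj => ?_
      by_contra! hlt
      refine hS (Set.mem_iUnion.2 ⟨(i, j), ?_⟩)
      simp only [bad, if_pos (And.intro hij hj)]
      exact Set.mem_iUnion.2 ⟨C', hlt⟩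
  have h1 : 1 ≤ (sampleLaw C q).real {S | IsSmoothRegretApprox G (2 * ε) C (estimator G C S)} +
      (sampleLaw C q).real (⋃ p, bad p) := by
    rw [← probReal_univ (μ := sampleLaw C q)]
    exact (measureReal_mono hcover).trans (measureReal_union_le _ _)
  have h2 : (sampleLaw C q).real (⋃ p, bad p) ≤ k ^ 4 * B := by
    refine (measureReal_iUnion_fintype_le _).trans ((Finset.sum_le_sum fun p _ => hbad p).trans
      (le_of_eq ?_))
    simp
    ring
  linarith

end Union

/-! ### Choice of the constant and conclusion. -/

theorem failure_bound_le {n k : ℕ} (hn : 2 ≤ n) (hk : 1 ≤ k) {x : ℝ} (hx : 0 ≤ x)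
    (hxn : x ≤ (((n : ℝ) ^ k) ^ 16)⁻¹) :
    k ^ 4 * (2 * x * (1 + k * x) ^ n) ≤ ((n : ℝ) ^ 3)⁻¹ := by
  -- $P$ dominates 2, $n$ and $k$, so every factor becomes a power of $P$: the bound is $P^4\cdot
  -- P\cdot P^{-16}\cdot P^2=P^{-9}$.
  set P : ℝ := (n : ℝ) ^ k with hP
  have hn1 : (1 : ℝ) ≤ n := by exact_mod_cast one_le_two.trans hn
  have hnP : (n : ℝ) ≤ P := le_self_pow₀ hn1 (by omega)
  have h2P : (2 : ℝ) ≤ P := le_trans (by exact_mod_cast hn) hnP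
  have hkP : (k : ℝ) ≤ P := by
    rw [hP]
    exact_mod_cast (Nat.lt_pow_self (by omega : 1 < n)).le
  have hP0 : 0 < P := by linarith
  have hxP : x * P ^ 16 ≤ 1 := by
    have := mul_le_mul_of_nonneg_right hxn (by positivity : 0 ≤ P ^ 16)
    rwa [inv_mul_cancel₀ (by positivity)] at this
  have hpow : (1 + k * x) ^ n ≤ P ^ 2 := by
    have h1 : (1 + k * x) ^ n ≤ Real.exp (n * (k * x)) := by
      rw [Real.exp_nat_mul]
      refine pow_le_pow_left₀ (by positivity) ?_ n
      rw [add_comm]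
      exact Real.add_one_le_exp _
    have h2 : n * (k * x) ≤ 1 := by
      calc n * (k * x) ≤ P * (P * x) := by gcongr
        _ = x * P ^ 2 := by ring
        _ ≤ x * P ^ 16 := by gcongr <;> linarith
        _ ≤ 1 := hxP
    have h3 : Real.exp 1 ≤ 4 := by linarith [Real.exp_one_lt_d9]
    calc (1 + k * x) ^ n ≤ Real.exp 1 := h1.trans (Real.exp_le_exp.2 h2)
      _ ≤ 2 ^ 2 := by linarith
      _ ≤ P ^ 2 := by gcongr
  have hx2 : x ≤ (P ^ 16)⁻¹ := hxn
  calc k ^ 4 * (2 * x * (1 + k * x) ^ n) ≤ P ^ 4 * (P * (P ^ 16)⁻¹ * P ^ 2) := by gcongr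
    _ = (P ^ 9)⁻¹ := by field_simp
    _ ≤ (P ^ 3)⁻¹ := inv_anti₀ (by positivity)
        (pow_le_pow_right₀ (by linarith) (by norm_num))
    _ ≤ _ := inv_anti₀ (by positivity) (by gcongr)

end CorrClust

theorem lemma3 :
    ∃ c₂ : ℝ, 0 < c₂ ∧
      ∀ (V : Type*) [Fintype V] [DecidableEq V] [MeasurableSpace V] [DiscreteMeasurableSpace V]
        (G : SimpleGraph V) [DecidableRel G.Adj] (k : ℕ) (C : CorrClust.Clustering V k)
        (_ : Antitone (fun j : Fin k => (CorrClust.cluster C j).card))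
        (ε : ℝ) (_ : 0 < ε) (_ : ε ≤ 1)
        (q : ℕ) (_ : c₂ * (k : ℝ) ^ 2 * Real.log (Fintype.card V) / ε ^ 4 ≤ (q : ℝ)),
        1 - ((Fintype.card V : ℝ) ^ 3)⁻¹ ≤
          (CorrClust.sampleLaw C q).real
            {S | CorrClust.IsSmoothRegretApprox G (3 * ε) C (CorrClust.estimator G C S)} := by
  -- $256=16\cdot16$: since $q\varepsilon^2\ge q\varepsilon^4\ge256k^2\log n$, the exponent
  -- $q\varepsilon^2/(16k)$ is at least $16k\log n$, that is, $x\le n^{-16k}$.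
  refine ⟨256, by norm_num, ?_⟩
  intro V _ _ _ _ G _ k C hC ε hε hε1 q hq
  rcases Nat.lt_or_ge (Fintype.card V) 2 with hn | hn
  · have hcases : Fintype.card V = 0 ∨ Fintype.card V = 1 := by omega
    rcases hcases with h0 | h1
    -- For $n=0$ the convention $0^{-1}=0$ turns the claim into probability at least 1; it holds
    -- because all the sums are empty.
    · have := Fintype.card_eq_zero_iff.1 h0
      have huniv : {S | CorrClust.IsSmoothRegretApprox G (3 * ε) C
          (CorrClust.estimator G C S)} = (Set.univ : Set (CorrClust.Sample C q)) := by
        refine Set.eq_univ_of_forall fun S C' => ?_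
        simp [CorrClust.regret, CorrClust.cost, CorrClust.dist, CorrClust.estimator,
          CorrClust.cluster]
      rw [huniv, MeasureTheory.probReal_univ]
      simp
    · rw [h1]
      simp
  have hne : Nonempty V := Fintype.card_pos_iff.1 (by omega)
  have hk : 1 ≤ k := (C hne.some).pos
  have hk' : (1 : ℝ) ≤ k := by exact_mod_cast hk
  have hn' : (1 : ℝ) < Fintype.card V := by exact_mod_cast hn
  have hlog := Real.log_pos hn'
  have hqpos : 0 < q := by
    have : (0 : ℝ) < q := lt_of_lt_of_le (by positivity) hq
    exact_mod_cast this
  have hx : Real.exp (-(q * ε ^ 2 / (16 * k))) ≤ (((Fintype.card V : ℝ) ^ k) ^ 16)⁻¹ := by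
    rw [Real.exp_neg]
    refine inv_anti₀ (by positivity) ?_
    rw [← Real.log_le_iff_le_exp (by positivity), Real.log_pow, Real.log_pow,
      le_div_iff₀ (by positivity)]
    rw [div_le_iff₀ (by positivity)] at hq
    have hq2 : q * ε ^ 4 ≤ q * ε ^ 2 :=
      mul_le_mul_of_nonneg_left (pow_le_pow_of_le_one hε.le hε1 (by norm_num)) (Nat.cast_nonneg q)
    push_cast
    linarith
  have hbound := CorrClust.failure_bound_le hn hk (Real.exp_pos _).le hx
  refine (sub_le_sub_left hbound 1).trans
    ((CorrClust.one_sub_le_measureReal_isSmoothRegretApprox G hC hqpos hε hε1).trans ?_)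
  refine MeasureTheory.measureReal_mono fun S hS C' => (hS C').trans ?_
  refine mul_le_mul_of_nonneg_right (by linarith) ?_
  rw [CorrClust.dist_eq G]
  exact mul_nonneg (by norm_num)
    (Finset.sum_nonneg fun _ _ => Finset.sum_nonneg fun _ _ => abs_nonneg _)
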